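/- **Setting.** Let $X\subset\mathbb R^d$ be a compact convex set with at least two points, with diameter $D_X$, let $\Xi$ be a measurable space and $f:X\times\Xi\to\mathbb R$ a loss. For a probability distribution $\mathcal D$ on $\Xi$ put $F^{\mathcal D}(x)=\mathbb E_{\xi\sim\mathcal D}[f(x,\xi)]$, $\nabla F^{\mathcal D}(x)=\mathbb E_{\xi\sim\mathcal D}[\nabla f(x,\xi)]$ and $\sigma^2_{\mathcal D}=\sup_{x\in X}\mathbb E_{\xi\sim\mathcal D}\|\nabla f(x,\xi)-\nabla F^{\mathcal D}(x)\|^2$ (gradients are in $x$). For distributions $\mathcal D_1,\dots,\mathcal D_T$ put $$\sigma_{\max}^2=\max_{1\le t\le T}\sigma_{\mathcal D_t}^2,\qquad \Sigma_{\max}^2=\max_{2\le t\le T}\ \sup_{x\in X}\|\nabla F^{\mathcal D_t}(x)-\nabla F^{\mathcal D_{t-1}}(x)\|^2 .$$ Consider the following assumptions on $f$ and a distribution $\mathcal D$: (A1) every $f(\cdot,\xi)$ is convex and, for $\mathcal D$-almost every $\xi$, $\|\nabla f(x,\xi)\|\le G$ for all $x\in X$; (A2) $\nabla F^{\mathcal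 D}$ is $L$-Lipschitz on $X$; (A3) for every $x\in X$ the variance $\mathbb E_{\xi\sim\mathcal D}\|\nabla f(x,\xi)-\nabla F^{\mathcal D}(x)\|^2$ is finite; (A4) $F^{\mathcal D}$ is $\mu$-strongly convex on $X$. A (possibly randomized) learner, who is told $X$, $\mu$, $T$ and $f$ but not the distributions, chooses in each round $t=1,\dots,T$ a point $x_t\in X$ depending measurably on $\xi_1,\dots,\xi_{t-1}$ and its internal randomness; then $\xi_t\sim\mathcal D_t$ is drawn (the $\xi_t$ are independent of each other and of the internal randomness) and revealed. The expected regret against $u\in X$ is $\mathbb E[R_T(u)]=\mathbb E\big[\sum_{t=1}^T (f(x_t,\xi_t)-f(u,\xi_t))\big]$. **Theorem.** There are absolute constants $c,C>0$ such that the following holds for all $d$ and $X\subset\mathbb R^d$ as above, all $\mu,\sigma,\Sigma>0$, and all $T\ge C\big(1+\tfrac{\max(\sigma,\Sigma)}{\mu D_X}\big)^4$. For every learner there are a measurable space $\Xi$, a loss $f:X\times\Xi\to\mathbb R$ and a sequence of distributions $\mathcal D_1,\dots,\mathcal D_T$ on $\Xi$, each satisfying (A1)–(A4) with strong convexity constant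 $\mu$, smoothness constant $L=\mu$ and gradient bound $G=\max(\sigma,\Sigma/2)+\mu D_X$, such that $\sigma_{\max}\ge\sigma$, $\Sigma_{\max}\ge\Sigma$, and for some $u\in X$ $$\mathbb E[R_T(u)]\ \ge\ c\,\frac{\sigma_{\max}^2+\Sigma_{\max}^2}{\mu}\,\log T .$$ -/

import Mathlib

open MeasureTheory

noncomputable section

/-- Euclidean space `ℝ^d`. -/
abbrev Euc (d : ℕ) : Type := EuclideanSpace ℝ (Fin d)

section Distributions

variable {d : ℕ} {Ξ : Type} [MeasurableSpace Ξ]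

/-- The gradient `∇ f(x, ξ)` of the loss in its first argument. -/
def lossGrad (f : Euc d → Ξ → ℝ) (x : Euc d) (ξ : Ξ) : Euc d :=
  gradient (fun y => f y ξ) x

/-- The mean function `F^D(x) = E_{ξ ∼ D} [f(x, ξ)]`. -/
def meanLoss (f : Euc d → Ξ → ℝ) (D : Measure Ξ) (x : Euc d) : ℝ :=
  ∫ ξ, f x ξ ∂D

/-- The gradient mean `∇F^D(x) = E_{ξ ∼ D} [∇ f(x, ξ)]`. -/
def meanGrad (f : Euc d → Ξ → ℝ) (D : Measure Ξ) (x : Euc d) : Euc d :=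
  ∫ ξ, lossGrad f x ξ ∂D

/-- The variance of the gradients,
`σ²_D = sup_{x ∈ X} E_{ξ ∼ D} ‖∇ f(x, ξ) - ∇F^D(x)‖²`. -/
def stochVar (X : Set (Euc d)) (f : Euc d → Ξ → ℝ) (D : Measure Ξ) : ℝ :=
  ⨆ x : X, ∫ ξ, ‖lossGrad f x ξ - meanGrad f D x‖ ^ 2 ∂D

/-- The variation between two distributions, `sup_{x ∈ X} ‖∇F^D(x) - ∇F^{D'}(x)‖²`. -/
def advVar (X : Set (Euc d)) (f : Euc d → Ξ → ℝ) (D D' : Measure Ξ) : ℝ :=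
  ⨆ x : X, ‖meanGrad f D x - meanGrad f D' x‖ ^ 2

/-- `σ²_max`, the maximum of `σ²_{D_t}` over the rounds. The `T` rounds are numbered
`0, …, T - 1`; the distributions `D t` with `T ≤ t` play no role. -/
def sigmaMaxSq (X : Set (Euc d)) (f : Euc d → Ξ → ℝ) (T : ℕ) (D : ℕ → Measure Ξ) : ℝ :=
  ⨆ t : Fin T, stochVar X f (D t)

/-- `Σ²_max`, the maximum of `sup_{x ∈ X} ‖∇F^{t}(x) - ∇F^{t-1}(x)‖²` over all pairs of
consecutive rounds `t - 1, t` among the `T` rounds. -/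
def bigSigmaMaxSq (X : Set (Euc d)) (f : Euc d → Ξ → ℝ) (T : ℕ) (D : ℕ → Measure Ξ) : ℝ :=
  ⨆ t : Fin (T - 1), advVar X f (D (t + 1)) (D t)

/-- The assumptions on the loss `f` and on a distribution `D`, with gradient bound `G`,
smoothness constant `L` and strong convexity constant `μ`. -/
structure Assumptions (X : Set (Euc d)) (f : Euc d → Ξ → ℝ) (G L μ : ℝ)
    (D : Measure Ξ) : Prop where
  /-- regularity needed for the notions below to make sense -/
  measurable : Measurable (fun p : Euc d × Ξ => f p.1 p.2)
  differentiable : ∀ ξ, ∀ x ∈ X, DifferentiableAt ℝ (fun y => f y ξ) x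
  integrable : ∀ x ∈ X, Integrable (fun ξ => f x ξ) D
  integrable_grad : ∀ x ∈ X, Integrable (fun ξ => lossGrad f x ξ) D
  /-- the losses are convex -/
  convex : ∀ ξ, ConvexOn ℝ X (fun x => f x ξ)
  /-- the gradients are almost surely bounded by `G` -/
  grad_bound : ∀ᵐ ξ ∂D, ∀ x ∈ X, ‖lossGrad f x ξ‖ ≤ G
  /-- the expected function is `L`-smooth -/
  smooth : ∀ x ∈ X, ∀ y ∈ X, ‖meanGrad f D x - meanGrad f D y‖ ≤ L * ‖x - y‖
  /-- the variance of the gradients is finite -/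
  finite_variance : ∀ x ∈ X,
    Integrable (fun ξ => ‖lossGrad f x ξ - meanGrad f D x‖ ^ 2) D
  /-- the expected function is `μ`-strongly convex -/
  strongConvex : StrongConvexOn X μ (meanLoss f D)

end Distributions

section Learners

/-- A randomized strategy of play in `X`: `play t ω h` is the point chosen after the `t`
samples `h` have been observed, when the internal randomness of the learner is `ω`. -/
structure Policy {d : ℕ} (X : Set (Euc d)) (Ω : Type*) [MeasurableSpace Ω]
    (Ξ : Type) [MeasurableSpace Ξ] where
  play : (t : ℕ) → Ω → (Fin t → Ξ) → Euc d
  play_mem : ∀ t ω h, play t ω h ∈ X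
  measurable_play : ∀ t, Measurable (fun p : Ω × (Fin t → Ξ) => play t p.1 p.2)

/-- A learning algorithm on `X` with internal randomness in `Ω`: it is told the sample space
and the loss `f` (but not the distributions), and then plays according to some policy. -/
structure Learner {d : ℕ} (X : Set (Euc d)) (Ω : Type*) [MeasurableSpace Ω] where
  policy : ∀ (Ξ : Type) [MeasurableSpace Ξ], (Euc d → Ξ → ℝ) → Policy X Ω Ξ

variable {d : ℕ} {X : Set (Euc d)} {Ω : Type*} [MeasurableSpace Ω]
  {Ξ : Type} [MeasurableSpace Ξ]

/-- The point `x_t` played in round `t` when the samples are `ξ`; it depends only on the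
samples of the earlier rounds. -/
def Policy.point (π : Policy X Ω Ξ) {T : ℕ} (ω : Ω) (ξ : Fin T → Ξ) (t : Fin T) : Euc d :=
  π.play t ω (fun s => ξ (Fin.castLE t.isLt.le s))

/-- The expected regret `E [∑_t (f(x_t, ξ_t) - f(u, ξ_t))]` over `T` rounds against `u`, where
the samples `ξ_t ∼ D_t` are independent of each other and of the internal randomness. -/
def expRegret (P : Measure Ω) (π : Policy X Ω Ξ) (f : Euc d → Ξ → ℝ) (T : ℕ)
    (D : ℕ → Measure Ξ) (u : Euc d) : ℝ :=
  ∫ z : Ω × (Fin T → Ξ), ∑ t : Fin T, (f (π.point z.1 z.2 t) (z.2 t) - f u (z.2 t))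
    ∂(P.prod (Measure.pi fun t : Fin T => D t))

end Learners

end

/-!
Let `e` be a unit vector along a segment of `X` with midpoint `m` and length at least half the
diameter. All losses are `μ / 2 * ‖x - m‖ ^ 2 + s * ε * ⟪e, x - m⟫` with a random sign `ε` and
`s = max σ (Σ / 2)`. If `ε` has mean `θ`, the mean loss is minimized at `m - (θ * s / μ) • e`, and
the expected regret of a round against this point is `s ^ 2 / (2 * μ)` times the squared error of
an estimate of `θ` from the previous signs (at least: randomization and motion orthogonal to `e`
are of no use to the learner). So the theorem is a statement on the sequential estimation of a mean.

For `n` independent signs the Fisher information at `|θ| ≤ r ≤ 1 / 2` is at most `4 n / 3`, and the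
prior proportional to `(r² - θ²)²` on `[-r, r]` has information `10 / r²`. The van Trees inequality
(`van_trees`) bounds the Bayes risk of every estimator from below by `1 / (10 / r² + 4 n / 3)`.
Summing over the rounds, some `θ` in `[-r, r]` costs the learner a total squared error of order
`log (T r²)` (`exists_mean_log_le`). The minimizers lie in `X` for `r` of order `min 1 (μ D_X / s)`,
and then `log (T r²)` is of order `log T` because `T` is at least a large multiple of `r⁻⁴`.

In the last three rounds the sign is surely `1`, surely `-1` and fair, which gives
`Σ_max = 2 s ≥ Σ` and `σ_max = s ≥ σ`. Such a round lowers the regret by at most `2 * s ^ 2 / μ`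
(`estimation_error_le_expRegret`), which is absorbed by the logarithm.
-/

/-! ### Expectations over independent signs -/

/-- The sign `1` or `-1` encoded by a Boolean. -/
noncomputable def sgn (b : Bool) : ℝ := if b then 1 else -1

/-- The weight of `b` under the law on signs with mean `θ`. -/
noncomputable def signWeight (θ : ℝ) (b : Bool) : ℝ := (1 + sgn b * θ) / 2

/-- The expectation of `F` over `n` independent signs, the `i`-th of mean `β i`, written as a
finite sum. -/
noncomputable def signExp (β : ℕ → ℝ) (n : ℕ) (F : (Fin n → Bool) → ℝ) : ℝ :=
  ∑ h, (∏ i : Fin n, signWeight (β i) (h i)) * F h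

lemma signWeight_nonneg {θ : ℝ} (h₁ : -1 ≤ θ) (h₂ : θ ≤ 1) (b : Bool) : 0 ≤ signWeight θ b := by
  cases b <;> simp [signWeight, sgn] <;> linarith

lemma signExp_succ (β : ℕ → ℝ) (n : ℕ) (F : (Fin (n + 1) → Bool) → ℝ) :
    signExp β (n + 1) F =
      signExp β n fun h => ∑ b, signWeight (β n) b * F (Fin.snoc h b) := by
  unfold signExp
  rw [← (Fin.snocEquiv fun _ => Bool).sum_comp, Fintype.sum_prod_type_right]
  refine Finset.sum_congr rfl fun h _ => ?_
  rw [Finset.mul_sum]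
  refine Finset.sum_congr rfl fun b _ => ?_
  rw [Fin.prod_univ_castSucc]
  simp [Fin.snocEquiv]
  ring

lemma signExp_add (β : ℕ → ℝ) (n : ℕ) (F G : (Fin n → Bool) → ℝ) :
    signExp β n (fun h => F h + G h) = signExp β n F + signExp β n G := by
  simp [signExp, mul_add, Finset.sum_add_distrib]

lemma signExp_const_mul (β : ℕ → ℝ) (n : ℕ) (a : ℝ) (F : (Fin n → Bool) → ℝ) :
    signExp β n (fun h => a * F h) = a * signExp β n F := by
  simp only [signExp, Finset.mul_sum]
  exact Finset.sum_congr rfl fun h _ => by ring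

lemma signExp_const (β : ℕ → ℝ) (n : ℕ) (a : ℝ) : signExp β n (fun _ => a) = a := by
  induction n with
  | zero => simp [signExp]
  | succ n ih =>
    rw [signExp_succ]
    convert ih using 2
    funext h
    simp [signWeight, sgn]
    ring

lemma signExp_mono {β : ℕ → ℝ} (h₁ : ∀ t, -1 ≤ β t) (h₂ : ∀ t, β t ≤ 1) (n : ℕ)
    {F G : (Fin n → Bool) → ℝ} (h : ∀ x, F x ≤ G x) : signExp β n F ≤ signExp β n G :=
  Finset.sum_le_sum fun x _ => mul_le_mul_of_nonneg_left (h x)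
    (Finset.prod_nonneg fun i _ => signWeight_nonneg (h₁ i) (h₂ i) _)

lemma signExp_congr {β γ : ℕ → ℝ} {n : ℕ} (h : ∀ i < n, β i = γ i)
    (F : (Fin n → Bool) → ℝ) : signExp β n F = signExp γ n F := by
  unfold signExp
  refine Finset.sum_congr rfl fun x _ => ?_
  rw [Finset.prod_congr rfl fun i _ => by rw [h i i.isLt]]

/-- Signs after the first `n` may be integrated out. -/
lemma signExp_castLE (β : ℕ → ℝ) {n T : ℕ} (hT : n ≤ T) (F : (Fin n → Bool) → ℝ) :
    signExp β T (fun h => F fun i => h (Fin.castLE hT i)) = signExp β n F := by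
  induction T, hT using Nat.le_induction with
  | base => rfl
  | succ T hT ih =>
    rw [signExp_succ, ← ih]
    congr 1
    funext h
    have : ∀ b : Bool, (fun i : Fin n => (Fin.snoc h b : Fin (T + 1) → Bool)
        (Fin.castLE (hT.trans T.le_succ) i)) = fun i => h (Fin.castLE hT i) := by
      intro b
      funext i
      exact Fin.snoc_castSucc (α := fun _ => Bool) b h (Fin.castLE hT i)
    simp only [this]
    simp [signWeight, sgn]
    ring

/-- A sign is independent of the earlier ones. -/
lemma signExp_history (β : ℕ → ℝ) {T : ℕ} (t : Fin T) (F : (Fin t → Bool) → Bool → ℝ) :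
    signExp β T (fun h => F (fun s => h (Fin.castLE t.isLt.le s)) (h t)) =
      signExp β t fun h => ∑ b, signWeight (β t) b * F h b := by
  have := signExp_castLE β (n := t + 1) (T := T) t.isLt
    fun h => F (fun s => h s.castSucc) (h (Fin.last t))
  rw [signExp_succ] at this
  simp only [Fin.snoc_castSucc, Fin.snoc_last] at this
  exact this

/-! ### The van Trees inequality for random signs -/

/-- The score, the derivative in `θ` of the logarithm of the likelihood of the signs `h`. -/
noncomputable def score (θ : ℝ) {n : ℕ} (h : Fin n → Bool) : ℝ :=
  ∑ i, sgn (h i) / (1 + sgn (h i) * θ)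

lemma one_add_sgn_mul_pos {θ : ℝ} (h₁ : -1 < θ) (h₂ : θ < 1) (b : Bool) : 0 < 1 + sgn b * θ := by
  cases b <;> simp [sgn] <;> linarith

/-- The score is centred and its variance, the Fisher information, is `n / (1 - θ ^ 2)`. -/
lemma signExp_affine_score_sq {θ : ℝ} (h₁ : -1 < θ) (h₂ : θ < 1) (n : ℕ) (p q : ℝ) :
    signExp (fun _ => θ) n (fun h => (p + q * score θ h) ^ 2) =
      p ^ 2 + q ^ 2 * (n / (1 - θ ^ 2)) := by
  induction n with
  | zero => simp [signExp, score]
  | succ n ih =>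
    have ha : (1 + θ) ≠ 0 := by linarith
    have hb : (1 - θ) ≠ 0 := by linarith
    have hc : 1 - θ ^ 2 ≠ 0 := by
      have : 1 - θ ^ 2 = (1 + θ) * (1 - θ) := by ring
      rw [this]; exact mul_ne_zero ha hb
    have key : ∀ h : Fin n → Bool,
        ∑ b, signWeight θ b * (p + q * score θ (Fin.snoc h b : Fin (n + 1) → Bool)) ^ 2 =
          (p + q * score θ h) ^ 2 + q ^ 2 * (1 / (1 - θ ^ 2)) := by
      intro h
      have hs : ∀ b, score θ (Fin.snoc h b : Fin (n + 1) → Bool) =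
          score θ h + sgn b / (1 + sgn b * θ) := by
        intro b
        simp [score, Fin.sum_univ_castSucc]
      simp only [hs, Fintype.sum_bool]
      have e1 : sgn true = 1 := rfl
      have e2 : sgn false = -1 := rfl
      simp only [signWeight, e1, e2]
      have hb' : 1 + -1 * θ ≠ 0 := by linarith
      have hd : 1 - θ ^ 2 = (1 + θ) * (1 + -1 * θ) := by ring
      rw [hd, one_mul]
      generalize score θ h = S
      generalize he : 1 + -1 * θ = e at *
      have : θ = 1 - e := by linarith
      subst this
      have ha' : 1 + (1 - e) ≠ 0 := ha
      field_simp
      ring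
    rw [signExp_succ]
    simp only [key]
    rw [signExp_add, ih, signExp_const]
    push_cast
    ring

lemma hasDerivAt_likelihood {θ : ℝ} (h₁ : -1 < θ) (h₂ : θ < 1) {n : ℕ} (h : Fin n → Bool) :
    HasDerivAt (fun θ => ∏ i, signWeight θ (h i))
      ((∏ i, signWeight θ (h i)) * score θ h) θ := by
  have hw : ∀ b, HasDerivAt (fun θ => signWeight θ b) (sgn b / 2) θ := by
    intro b
    have := (((hasDerivAt_id θ).const_mul (sgn b)).const_add 1).div_const 2
    simpa [signWeight] using this
  have := HasDerivAt.fun_finsetProd (u := Finset.univ) fun i _ => hw (h i)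
  refine this.congr_deriv ?_
  unfold score
  rw [Finset.mul_sum]
  refine Finset.sum_congr rfl fun i hi => ?_
  rw [← Finset.mul_prod_erase _ _ hi, smul_eq_mul, signWeight]
  have := (one_add_sgn_mul_pos h₁ h₂ (h i)).ne'
  field_simp

lemma continuousOn_score {S : Set ℝ} (hS : ∀ θ ∈ S, -1 < θ ∧ θ < 1) {n : ℕ} (h : Fin n → Bool) :
    ContinuousOn (fun θ => score θ h) S := by
  unfold score
  refine continuousOn_finsetSum _ fun i _ => ContinuousOn.div (by fun_prop) (by fun_prop) ?_
  intro θ hθ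
  exact (one_add_sgn_mul_pos (hS θ hθ).1 (hS θ hθ).2 _).ne'

lemma continuous_signExp {n : ℕ} {F : ℝ → (Fin n → Bool) → ℝ}
    (hF : ∀ h, Continuous fun θ => F θ h) :
    Continuous fun θ => signExp (fun _ => θ) n (F θ) := by
  unfold signExp signWeight
  fun_prop

/-- Integration by parts against the prior density `(r² - θ²)²`, which vanishes at `± r`. -/
lemma integral_estimator_mul_score {r : ℝ} (hr : 0 < r) (hr1 : r < 1) (n : ℕ)
    (g : (Fin n → Bool) → ℝ) :
    ∫ θ in -r..r, signExp (fun _ => θ) n (fun h => (g h - θ) * (r ^ 2 - θ ^ 2) *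
        (-4 * θ + (r ^ 2 - θ ^ 2) * score θ h)) = ∫ θ in -r..r, (r ^ 2 - θ ^ 2) ^ 2 := by
  have hI : ∀ θ ∈ Set.uIcc (-r) r, -1 < θ ∧ θ < 1 := by
    intro θ hθ
    rw [Set.uIcc_of_le (by linarith)] at hθ
    exact ⟨by linarith [hθ.1], by linarith [hθ.2]⟩
  -- the antiderivative of the difference of the two integrands
  have hder : ∀ θ ∈ Set.uIcc (-r) r,
      HasDerivAt (fun θ => signExp (fun _ => θ) n fun h => (g h - θ) * (r ^ 2 - θ ^ 2) ^ 2)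
        (signExp (fun _ => θ) n (fun h => (g h - θ) * (r ^ 2 - θ ^ 2) *
          (-4 * θ + (r ^ 2 - θ ^ 2) * score θ h)) - (r ^ 2 - θ ^ 2) ^ 2) θ := by
    intro θ hθ
    have h0 : signExp (fun _ => θ) n (fun h => (g h - θ) * (r ^ 2 - θ ^ 2) *
          (-4 * θ + (r ^ 2 - θ ^ 2) * score θ h)) - (r ^ 2 - θ ^ 2) ^ 2 =
        signExp (fun _ => θ) n (fun h => (g h - θ) * (r ^ 2 - θ ^ 2) *
          (-4 * θ + (r ^ 2 - θ ^ 2) * score θ h) + -(r ^ 2 - θ ^ 2) ^ 2) := by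
      rw [signExp_add, signExp_const, sub_eq_add_neg]
    rw [h0]
    unfold signExp
    refine HasDerivAt.fun_sum fun h _ => ?_
    have hq := hasDerivAt_likelihood (hI θ hθ).1 (hI θ hθ).2 h
    have ha : HasDerivAt (fun θ => (g h - θ) * (r ^ 2 - θ ^ 2) ^ 2)
        ((-1) * (r ^ 2 - θ ^ 2) ^ 2 + (g h - θ) * (2 * (r ^ 2 - θ ^ 2) * (-(2 * θ)))) θ := by
      have h1 : HasDerivAt (fun θ => g h - θ) (-1) θ := (hasDerivAt_id θ).const_sub _
      have h2 : HasDerivAt (fun θ => r ^ 2 - θ ^ 2) (-(2 * θ)) θ := by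
        simpa using (hasDerivAt_pow 2 θ).const_sub (r ^ 2)
      have h3 := h2.fun_pow 2
      simpa using h1.fun_mul h3
    refine (hq.mul ha).congr_deriv ?_
    ring
  have hint1 : IntervalIntegrable (fun θ => signExp (fun _ => θ) n (fun h =>
      (g h - θ) * (r ^ 2 - θ ^ 2) * (-4 * θ + (r ^ 2 - θ ^ 2) * score θ h)))
      volume (-r) r := by
    apply ContinuousOn.intervalIntegrable
    unfold signExp
    refine continuousOn_finsetSum _ fun h _ => ?_
    have hp : Continuous fun θ => ∏ i, signWeight θ (h i) := by
      unfold signWeight; fun_prop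
    exact hp.continuousOn.mul ((by fun_prop : Continuous fun θ =>
      (g h - θ) * (r ^ 2 - θ ^ 2)).continuousOn.mul
      ((by fun_prop : Continuous fun θ : ℝ => -4 * θ).continuousOn.add
      ((by fun_prop : Continuous fun θ : ℝ => r ^ 2 - θ ^ 2).continuousOn.mul
        (continuousOn_score hI h))))
  have hint2 : IntervalIntegrable (fun θ : ℝ => (r ^ 2 - θ ^ 2) ^ 2) volume (-r) r :=
    (by fun_prop : Continuous fun θ : ℝ => (r ^ 2 - θ ^ 2) ^ 2).intervalIntegrable _ _
  have hftc := intervalIntegral.integral_eq_sub_of_hasDerivAt hder (hint1.sub hint2)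
  rw [intervalIntegral.integral_sub hint1 hint2] at hftc
  have hend : ∀ θ : ℝ, r ^ 2 - θ ^ 2 = 0 →
      signExp (fun _ => θ) n (fun h => (g h - θ) * (r ^ 2 - θ ^ 2) ^ 2) = 0 := by
    intro θ h0
    simp [h0, signExp]
  rw [hend r (by ring), hend (-r) (by ring)] at hftc
  linarith

/-- The total mass of the prior. -/
lemma integral_prior (r : ℝ) : ∫ θ in -r..r, (r ^ 2 - θ ^ 2) ^ 2 = 16 / 15 * r ^ 5 := by
  have : ∀ θ : ℝ, (r ^ 2 - θ ^ 2) ^ 2 = r ^ 4 - 2 * r ^ 2 * θ ^ 2 + θ ^ 4 := fun θ => by ring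
  simp only [this]
  rw [intervalIntegral.integral_add, intervalIntegral.integral_sub,
    intervalIntegral.integral_const_mul]
  · simp
    ring
  all_goals exact Continuous.intervalIntegrable (by fun_prop) _ _

/-- The van Trees inequality for `n` independent signs of unknown mean `θ`, with the prior
`(r² - θ²)²` on `[-r, r]`, whose Fisher information is `10 / r²`. -/
lemma van_trees {r : ℝ} (hr : 0 < r) (hr1 : r ≤ 1 / 2) (n : ℕ) (g : (Fin n → Bool) → ℝ) :
    16 / 15 * r ^ 5 * (1 / (10 / r ^ 2 + 4 / 3 * n)) ≤
      ∫ θ in -r..r, (r ^ 2 - θ ^ 2) ^ 2 * signExp (fun _ => θ) n (fun h => (g h - θ) ^ 2) := by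
  set c : ℝ := 1 / (10 / r ^ 2 + 4 / 3 * n) with hc
  clear_value c
  have hI := integral_estimator_mul_score hr (by linarith) n g
  -- `S ↦ 2 c (g - θ) S - c² S²` bounds `(g - θ)²` from below for every `c`; the `c` chosen here,
  -- applied to the score `S` of likelihood and prior together, gives the best bound.
  have hle : ∀ θ ∈ Set.Icc (-r) r, 2 * c * signExp (fun _ => θ) n (fun h =>
      (g h - θ) * (r ^ 2 - θ ^ 2) * (-4 * θ + (r ^ 2 - θ ^ 2) * score θ h)) -
      c ^ 2 * (16 * θ ^ 2 + 4 / 3 * n * (r ^ 2 - θ ^ 2) ^ 2) ≤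
      (r ^ 2 - θ ^ 2) ^ 2 * signExp (fun _ => θ) n (fun h => (g h - θ) ^ 2) := by
    intro θ hθ
    have h₁ : -1 < θ := by linarith [hθ.1]
    have h₂ : θ < 1 := by linarith [hθ.2]
    have hsc := signExp_affine_score_sq h₁ h₂ n (-4 * θ) (r ^ 2 - θ ^ 2)
    have h3 : (n : ℝ) / (1 - θ ^ 2) ≤ 4 / 3 * n := by
      have : θ ^ 2 ≤ 1 / 4 := by nlinarith [hθ.1, hθ.2]
      rw [div_le_iff₀ (by linarith)]
      nlinarith [(Nat.cast_nonneg n : (0 : ℝ) ≤ n)]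
    have h4 : c ^ 2 * ((-4 * θ) ^ 2 + (r ^ 2 - θ ^ 2) ^ 2 * (n / (1 - θ ^ 2))) ≤
        c ^ 2 * (16 * θ ^ 2 + 4 / 3 * n * (r ^ 2 - θ ^ 2) ^ 2) := by
      have := mul_le_mul_of_nonneg_left h3 (sq_nonneg (r ^ 2 - θ ^ 2))
      refine mul_le_mul_of_nonneg_left ?_ (sq_nonneg c)
      nlinarith
    have h5 : 2 * c * signExp (fun _ => θ) n (fun h =>
        (g h - θ) * (r ^ 2 - θ ^ 2) * (-4 * θ + (r ^ 2 - θ ^ 2) * score θ h)) ≤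
        (r ^ 2 - θ ^ 2) ^ 2 * signExp (fun _ => θ) n (fun h => (g h - θ) ^ 2) +
        c ^ 2 * signExp (fun _ => θ) n
          (fun h => (-4 * θ + (r ^ 2 - θ ^ 2) * score θ h) ^ 2) := by
      rw [← signExp_const_mul, ← signExp_const_mul, ← signExp_const_mul, ← signExp_add]
      refine signExp_mono (fun _ => h₁.le) (fun _ => h₂.le) n fun h => ?_
      nlinarith [sq_nonneg ((r ^ 2 - θ ^ 2) * (g h - θ) -
        c * (-4 * θ + (r ^ 2 - θ ^ 2) * score θ h))]
    rw [hsc] at h5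
    linarith
  have hint1 : IntervalIntegrable (fun θ => signExp (fun _ => θ) n (fun h =>
      (g h - θ) * (r ^ 2 - θ ^ 2) * (-4 * θ + (r ^ 2 - θ ^ 2) * score θ h)))
      volume (-r) r := by
    by_contra hcon
    -- the integral of a non-integrable function would be zero
    rw [intervalIntegral.integral_undef hcon, integral_prior] at hI
    have : 0 < r ^ 5 := by positivity
    linarith
  have hint2 : IntervalIntegrable
      (fun θ : ℝ => c ^ 2 * (16 * θ ^ 2 + 4 / 3 * n * (r ^ 2 - θ ^ 2) ^ 2)) volume (-r) r :=
    Continuous.intervalIntegrable (by fun_prop) _ _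
  have hint3 : IntervalIntegrable (fun θ : ℝ => (r ^ 2 - θ ^ 2) ^ 2 *
      signExp (fun _ => θ) n (fun h => (g h - θ) ^ 2)) volume (-r) r :=
    Continuous.intervalIntegrable
      (Continuous.mul (by fun_prop) (continuous_signExp fun h => by fun_prop)) _ _
  refine le_trans (le_of_eq ?_) (intervalIntegral.integral_mono_on (by linarith)
    ((hint1.const_mul (2 * c)).sub hint2) hint3 hle)
  rw [intervalIntegral.integral_sub (hint1.const_mul _) hint2,
    intervalIntegral.integral_const_mul, hI, intervalIntegral.integral_const_mul,
    intervalIntegral.integral_add, intervalIntegral.integral_const_mul,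
    intervalIntegral.integral_const_mul, integral_prior]
  · have hq : ∫ θ in -r..r, θ ^ 2 = 2 / 3 * r ^ 3 := by
      simp; ring
    rw [hq]
    have hpos : (0 : ℝ) < 10 / r ^ 2 + 4 / 3 * n := by positivity
    have hcm : c * (10 / r ^ 2 + 4 / 3 * n) = 1 := by
      rw [hc]; field_simp
    have : 16 * (2 / 3 * r ^ 3) + 4 / 3 * n * (16 / 15 * r ^ 5) =
        16 / 15 * r ^ 5 * (10 / r ^ 2 + 4 / 3 * n) := by
      field_simp; ring
    rw [this]
    linear_combination (16 / 15 * r ^ 5 * c) * hcm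
  all_goals exact Continuous.intervalIntegrable (by fun_prop) _ _

/-! ### The logarithmic lower bound for estimating the mean sign -/

lemma log_le_sum_inv {K : ℝ} (hK : 0 < K) (N : ℕ) :
    Real.log (N + K) - Real.log K ≤ ∑ n ∈ Finset.range N, 1 / (n + K) := by
  induction N with
  | zero => simp
  | succ N ih =>
    rw [Finset.sum_range_succ]
    have hp : 0 < (N : ℝ) + K := by positivity
    have h := Real.log_le_sub_one_of_pos (x := ((N : ℝ) + 1 + K) / (N + K)) (by positivity)
    rw [Real.log_div (by positivity) hp.ne'] at h
    have : ((N : ℝ) + 1 + K) / (N + K) - 1 = 1 / (N + K) := by field_simp; ring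
    push_cast
    linarith

/-- Whatever the estimators `g n` of a mean in `[-r, r]` from `n` signs are, for some mean the
first `N` of them have a total squared error that is logarithmic in `N`. -/
lemma exists_mean_log_le {r : ℝ} (hr : 0 < r) (hr1 : r ≤ 1 / 2) (N : ℕ)
    (g : (n : ℕ) → (Fin n → Bool) → ℝ) {B : ℝ}
    (hB : B < 3 / 4 * (Real.log (N + 15 / 2 / r ^ 2) - Real.log (15 / 2 / r ^ 2))) :
    ∃ θ ∈ Set.Icc (-r) r,
      B ≤ ∑ n ∈ Finset.range N, signExp (fun _ => θ) n (fun h => (g n h - θ) ^ 2) := by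
  by_contra! hcon
  have hcont : ∀ n, Continuous fun θ : ℝ => (r ^ 2 - θ ^ 2) ^ 2 *
      signExp (fun _ => θ) n (fun h => (g n h - θ) ^ 2) := fun n =>
    Continuous.mul (by fun_prop) (continuous_signExp fun h => by fun_prop)
  have h1 : 16 / 15 * r ^ 5 * ∑ n ∈ Finset.range N, 1 / (10 / r ^ 2 + 4 / 3 * (n : ℝ)) ≤
      ∫ θ in -r..r, ∑ n ∈ Finset.range N, (r ^ 2 - θ ^ 2) ^ 2 *
        signExp (fun _ => θ) n (fun h => (g n h - θ) ^ 2) := by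
    rw [intervalIntegral.integral_finsetSum fun n _ => (hcont n).intervalIntegrable _ _,
      Finset.mul_sum]
    exact Finset.sum_le_sum fun n _ => van_trees hr hr1 n (g n)
  have h2 : ∫ θ in -r..r, ∑ n ∈ Finset.range N, (r ^ 2 - θ ^ 2) ^ 2 *
        signExp (fun _ => θ) n (fun h => (g n h - θ) ^ 2) ≤
      ∫ θ in -r..r, B * (r ^ 2 - θ ^ 2) ^ 2 := by
    refine intervalIntegral.integral_mono_on (by linarith)
      ((continuous_finsetSum _ fun n _ => hcont n).intervalIntegrable _ _)
      (Continuous.intervalIntegrable (by fun_prop) _ _) fun θ hθ => ?_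
    rw [← Finset.mul_sum, mul_comm]
    exact mul_le_mul_of_nonneg_right (hcon θ hθ).le (sq_nonneg _)
  rw [intervalIntegral.integral_const_mul, integral_prior] at h2
  have h3 : ∑ n ∈ Finset.range N, 1 / (10 / r ^ 2 + 4 / 3 * (n : ℝ)) =
      3 / 4 * ∑ n ∈ Finset.range N, 1 / ((n : ℝ) + 15 / 2 / r ^ 2) := by
    rw [Finset.mul_sum]
    refine Finset.sum_congr rfl fun n _ => ?_
    have : (0 : ℝ) < n + 15 / 2 / r ^ 2 := by positivity
    have e : 10 / r ^ 2 + 4 / 3 * (n : ℝ) = 4 / 3 * (n + 15 / 2 / r ^ 2) := by ring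
    rw [e]
    field_simp
  have h4 := log_le_sum_inv (K := 15 / 2 / r ^ 2) (by positivity) N
  have hZ : 0 < 16 / 15 * r ^ 5 := by positivity
  have h5 : 16 / 15 * r ^ 5 * B < 16 / 15 * r ^ 5 *
      ∑ n ∈ Finset.range N, 1 / (10 / r ^ 2 + 4 / 3 * (n : ℝ)) :=
    mul_lt_mul_of_pos_left (by rw [h3]; linarith) hZ
  linarith

/-! ### Laws of signs as measures -/

/-- The law on signs with mean `θ`, for `θ ∈ [-1, 1]`. -/
noncomputable def signMeasure (θ : ℝ) : Measure Bool :=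
  ENNReal.ofReal (signWeight θ true) • Measure.dirac true +
    ENNReal.ofReal (signWeight θ false) • Measure.dirac false

instance (θ : ℝ) : IsFiniteMeasure (signMeasure θ) := by
  unfold signMeasure
  refine @isFiniteMeasureAdd _ _ _ _ ?_ ?_
  all_goals exact Measure.smul_finite _ ENNReal.ofReal_ne_top

lemma isProbabilityMeasure_signMeasure {θ : ℝ} (h₁ : -1 ≤ θ) (h₂ : θ ≤ 1) :
    IsProbabilityMeasure (signMeasure θ) := by
  constructor
  have h := signWeight_nonneg h₁ h₂
  simp only [signMeasure, Measure.add_apply, Measure.smul_apply, measure_univ, smul_eq_mul, mul_one]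
  rw [← ENNReal.ofReal_add (h _) (h _)]
  simp [signWeight, sgn]
  ring_nf

lemma signMeasure_real_singleton {θ : ℝ} (h₁ : -1 ≤ θ) (h₂ : θ ≤ 1) (b : Bool) :
    (signMeasure θ).real {b} = signWeight θ b := by
  have h := signWeight_nonneg h₁ h₂
  cases b <;> simp [signMeasure, Measure.real, h]

lemma integral_signMeasure {E : Type*} [NormedAddCommGroup E] [NormedSpace ℝ E]
    [CompleteSpace E]
    {θ : ℝ} (h₁ : -1 ≤ θ) (h₂ : θ ≤ 1) (g : Bool → E) :
    ∫ b, g b ∂signMeasure θ = signWeight θ true • g true + signWeight θ false • g false := by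
  rw [integral_fintype .of_finite, Fintype.sum_bool]
  simp only [signMeasure_real_singleton h₁ h₂]

lemma integral_pi_signMeasure {β : ℕ → ℝ} (h₁ : ∀ t, -1 ≤ β t) (h₂ : ∀ t, β t ≤ 1) (T : ℕ)
    (G : (Fin T → Bool) → ℝ) :
    ∫ h, G h ∂(Measure.pi fun t : Fin T => signMeasure (β t)) = signExp β T G := by
  rw [integral_fintype .of_finite, signExp]
  refine Finset.sum_congr rfl fun h _ => ?_
  rw [smul_eq_mul, Measure.real, Measure.pi_singleton, ENNReal.toReal_prod]
  congr 1
  exact Finset.prod_congr rfl fun i _ => signMeasure_real_singleton (h₁ i) (h₂ i) _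

/-! ### The tilted quadratic loss -/

/-- A quadratic bowl centred at `m`, tilted in the direction `e` with random sign. -/
noncomputable def tiltedLoss {d : ℕ} (μ s : ℝ) (m e : Euc d) (x : Euc d) (b : Bool) : ℝ :=
  μ / 2 * ‖x - m‖ ^ 2 + s * sgn b * inner ℝ e (x - m)

section Loss

variable {d : ℕ} {μ s : ℝ} {m e : Euc d}

lemma hasGradientAt_quadratic (μ β : ℝ) (m e x : Euc d) :
    HasGradientAt (fun y => μ / 2 * ‖y - m‖ ^ 2 + β * inner ℝ e (y - m))
      (μ • (x - m) + β • e) x := by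
  have h0 : HasFDerivAt (fun y : Euc d => y - m) (ContinuousLinearMap.id ℝ (Euc d)) x :=
    (hasFDerivAt_id x).sub_const m
  have h1 := (h0.norm_sq.const_mul (μ / 2)).add
    (((innerSL ℝ e).hasFDerivAt.comp x h0).const_mul β)
  rw [hasGradientAt_iff_hasFDerivAt]
  refine h1.congr_fderiv ?_
  ext v
  simp
  ring

lemma lossGrad_tiltedLoss (x : Euc d) (b : Bool) :
    lossGrad (tiltedLoss μ s m e) x b = μ • (x - m) + (s * sgn b) • e :=
  (hasGradientAt_quadratic μ (s * sgn b) m e x).gradient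

lemma meanGrad_tiltedLoss {β : ℝ} (h₁ : -1 ≤ β) (h₂ : β ≤ 1) (x : Euc d) :
    meanGrad (tiltedLoss μ s m e) (signMeasure β) x = μ • (x - m) + (s * β) • e := by
  rw [meanGrad, integral_signMeasure h₁ h₂, lossGrad_tiltedLoss, lossGrad_tiltedLoss]
  simp only [signWeight, sgn, if_true]
  simp
  module

lemma meanLoss_tiltedLoss {β : ℝ} (h₁ : -1 ≤ β) (h₂ : β ≤ 1) (x : Euc d) :
    meanLoss (tiltedLoss μ s m e) (signMeasure β) x =
      μ / 2 * ‖x - m‖ ^ 2 + s * β * inner ℝ e (x - m) := by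
  rw [meanLoss, integral_signMeasure h₁ h₂]
  simp [signWeight, sgn, tiltedLoss]
  ring

lemma strongConvexOn_quadratic {X : Set (Euc d)} (hX : Convex ℝ X) (μ β : ℝ) (m e : Euc d) :
    StrongConvexOn X μ fun x => μ / 2 * ‖x - m‖ ^ 2 + β * inner ℝ e (x - m) := by
  rw [strongConvexOn_iff_convex]
  have h : (fun x : Euc d => μ / 2 * ‖x - m‖ ^ 2 + β * inner ℝ e (x - m) - μ / 2 * ‖x‖ ^ 2) =
      fun x => (innerSL ℝ (β • e - μ • m)) x + (μ / 2 * ‖m‖ ^ 2 - β * inner ℝ e m) := by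
    funext x
    rw [norm_sub_sq_real]
    simp [inner_sub_right, real_inner_comm m x]
    ring
  rw [h]
  exact ((innerSL ℝ (β • e - μ • m)).toLinearMap.convexOn hX).add_const _

lemma tiltedLoss_assumptions {X : Set (Euc d)} (hX : Convex ℝ X) {D β : ℝ} (hμ : 0 ≤ μ)
    (hs : 0 ≤ s) (hD : ∀ x ∈ X, ‖x - m‖ ≤ D) (he : ‖e‖ = 1) (h₁ : -1 ≤ β) (h₂ : β ≤ 1) :
    Assumptions X (tiltedLoss μ s m e) (s + μ * D) μ μ (signMeasure β) where
  measurable := measurable_from_prod_countable_left fun b => by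
    unfold tiltedLoss
    exact Continuous.measurable (by fun_prop)
  differentiable b x _ := (hasGradientAt_quadratic μ (s * sgn b) m e x).differentiableAt
  integrable _ _ := .of_finite
  integrable_grad _ _ := .of_finite
  convex b := by
    have := (strongConvexOn_quadratic hX μ (s * sgn b) m e).mono hμ
    exact strongConvexOn_zero.mp this
  grad_bound := by
    refine Filter.Eventually.of_forall fun b x hx => ?_
    rw [lossGrad_tiltedLoss]
    refine (norm_add_le _ _).trans ?_
    rw [norm_smul, norm_smul, he, Real.norm_of_nonneg hμ]
    have h1 : ‖s * sgn b‖ = s := by cases b <;> simp [sgn, hs]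
    rw [h1]
    have := mul_le_mul_of_nonneg_left (hD x hx) hμ
    linarith
  smooth x _ y _ := by
    rw [meanGrad_tiltedLoss h₁ h₂, meanGrad_tiltedLoss h₁ h₂, add_sub_add_right_eq_sub,
      ← smul_sub, norm_smul, Real.norm_of_nonneg hμ, sub_sub_sub_cancel_right]
  finite_variance _ _ := .of_finite
  strongConvex := by
    have h : meanLoss (tiltedLoss μ s m e) (signMeasure β) =
        fun x => μ / 2 * ‖x - m‖ ^ 2 + s * β * inner ℝ e (x - m) :=
      funext fun x => meanLoss_tiltedLoss h₁ h₂ x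
    rw [h]
    exact strongConvexOn_quadratic hX μ (s * β) m e

lemma stochVar_tiltedLoss {X : Set (Euc d)} (hX : X.Nonempty) {β : ℝ} (he : ‖e‖ = 1)
    (h₁ : -1 ≤ β) (h₂ : β ≤ 1) :
    stochVar X (tiltedLoss μ s m e) (signMeasure β) = s ^ 2 * (1 - β ^ 2) := by
  have : Nonempty X := hX.to_subtype
  have h : ∀ x : X, ∫ b, ‖lossGrad (tiltedLoss μ s m e) x b -
      meanGrad (tiltedLoss μ s m e) (signMeasure β) x‖ ^ 2 ∂signMeasure β =
      s ^ 2 * (1 - β ^ 2) := by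
    intro x
    have h3 : ∀ b, ‖lossGrad (tiltedLoss μ s m e) x b -
        meanGrad (tiltedLoss μ s m e) (signMeasure β) x‖ ^ 2 = (s * sgn b - s * β) ^ 2 := by
      intro b
      rw [lossGrad_tiltedLoss, meanGrad_tiltedLoss h₁ h₂, add_sub_add_left_eq_sub, ← sub_smul,
        norm_smul, he, mul_one, Real.norm_eq_abs, sq_abs]
    simp only [h3]
    rw [integral_signMeasure h₁ h₂]
    simp [signWeight, sgn]
    ring
  simp only [stochVar, h, ciSup_const]

lemma advVar_tiltedLoss {X : Set (Euc d)} (hX : X.Nonempty) {β γ : ℝ} (he : ‖e‖ = 1)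
    (h₁ : -1 ≤ β) (h₂ : β ≤ 1) (h₃ : -1 ≤ γ) (h₄ : γ ≤ 1) :
    advVar X (tiltedLoss μ s m e) (signMeasure β) (signMeasure γ) = s ^ 2 * (β - γ) ^ 2 := by
  have : Nonempty X := hX.to_subtype
  have h : ∀ x : X, ‖meanGrad (tiltedLoss μ s m e) (signMeasure β) x -
      meanGrad (tiltedLoss μ s m e) (signMeasure γ) x‖ ^ 2 = s ^ 2 * (β - γ) ^ 2 := by
    intro x
    rw [meanGrad_tiltedLoss h₁ h₂, meanGrad_tiltedLoss h₃ h₄, add_sub_add_left_eq_sub, ← sub_smul,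
      norm_smul, he, mul_one, Real.norm_eq_abs, sq_abs]
    ring
  simp only [advVar, h, ciSup_const]

end Loss

/-! ### Regret as estimation error -/

section Regret

variable {d : ℕ} {X : Set (Euc d)} {Ω : Type*} [MeasurableSpace Ω]

/-- The displacement along `e`, averaged over the internal randomness, of the play after the
signs `h` have been observed. -/
noncomputable def meanPlay (P : Measure Ω) (π : Policy X Ω Bool) (m e : Euc d) (n : ℕ)
    (h : Fin n → Bool) : ℝ :=
  ∫ ω, inner ℝ e (π.play n ω h - m) ∂P

/-- Randomizing and moving orthogonally to `e` do not help the learner: the expected loss of a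
play is at least that of its mean displacement along `e`. -/
lemma le_integral_tiltedLoss_play (P : Measure Ω) [IsProbabilityMeasure P] (π : Policy X Ω Bool)
    {μ s D : ℝ} {m e : Euc d} (hμ : 0 ≤ μ) (he : ‖e‖ = 1) (hD : ∀ x ∈ X, ‖x - m‖ ≤ D)
    (n : ℕ) (h : Fin n → Bool) (b : Bool) :
    μ / 2 * meanPlay P π m e n h ^ 2 + s * sgn b * meanPlay P π m e n h ≤
      ∫ ω, tiltedLoss μ s m e (π.play n ω h) b ∂P := by
  have hplay : Measurable fun ω => π.play n ω h :=
    (π.measurable_play n).comp (measurable_id.prodMk measurable_const)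
  have hy : Measurable fun ω => inner ℝ e (π.play n ω h - m) :=
    (by fun_prop : Continuous fun x : Euc d => (inner ℝ e (x - m) : ℝ)).measurable.comp hplay
  have habs : ∀ ω, |inner ℝ e (π.play n ω h - m)| ≤ ‖π.play n ω h - m‖ := fun ω => by
    simpa [he] using abs_real_inner_le_norm e (π.play n ω h - m)
  have hiy : Integrable (fun ω => (inner ℝ e (π.play n ω h - m) : ℝ)) P :=
    .of_bound hy.aestronglyMeasurable D
      (.of_forall fun ω => (habs ω).trans (hD _ (π.play_mem n ω h)))
  have hin : Integrable (fun ω => ‖π.play n ω h - m‖ ^ 2) P := by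
    refine .of_bound (((by fun_prop : Continuous fun x : Euc d =>
      ‖x - m‖ ^ 2).measurable.comp hplay).aestronglyMeasurable) (D ^ 2) (.of_forall fun ω => ?_)
    rw [Real.norm_of_nonneg (sq_nonneg _)]
    have := hD _ (π.play_mem n ω h)
    gcongr
  set M := meanPlay P π m e n h
  -- the tangent of the square at the mean
  have hpt : ∀ ω, 2 * M * inner ℝ e (π.play n ω h - m) - M ^ 2 ≤ ‖π.play n ω h - m‖ ^ 2 := by
    intro ω
    have h1 := sq_le_sq' (by linarith [abs_le.mp (habs ω)]) (abs_le.mp (habs ω)).2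
    nlinarith [sq_nonneg (inner ℝ e (π.play n ω h - m) - M)]
  have hle : M ^ 2 ≤ ∫ ω, ‖π.play n ω h - m‖ ^ 2 ∂P := by
    have : ∫ ω, (2 * M * inner ℝ e (π.play n ω h - m) - M ^ 2) ∂P ≤
        ∫ ω, ‖π.play n ω h - m‖ ^ 2 ∂P :=
      integral_mono ((hiy.const_mul (2 * M)).sub (integrable_const (M ^ 2))) hin hpt
    rw [integral_sub (hiy.const_mul _) (integrable_const _), integral_const_mul] at this
    have e1 : ∫ ω, inner ℝ e (π.play n ω h - m) ∂P = M := rfl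
    rw [e1] at this
    simp at this
    linarith
  unfold tiltedLoss
  rw [integral_add (hin.const_mul _) (hiy.const_mul _), integral_const_mul, integral_const_mul]
  have e1 : ∫ ω, inner ℝ e (π.play n ω h - m) ∂P = M := rfl
  rw [e1]
  have := mul_le_mul_of_nonneg_left hle (by linarith : 0 ≤ μ / 2)
  linarith

lemma le_expRegret_tiltedLoss (P : Measure Ω) [IsProbabilityMeasure P] (π : Policy X Ω Bool)
    {μ s D : ℝ} {m e : Euc d} (hμ : 0 ≤ μ) (he : ‖e‖ = 1)
    (hD : ∀ x ∈ X, ‖x - m‖ ≤ D) (T : ℕ) {β : ℕ → ℝ} (h₁ : ∀ t, -1 ≤ β t) (h₂ : ∀ t, β t ≤ 1)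
    (τ : ℝ) :
    ∑ t ∈ Finset.range T, (signExp β t (fun h => μ / 2 * meanPlay P π m e t h ^ 2 +
        s * β t * meanPlay P π m e t h) - (μ / 2 * τ ^ 2 + s * β t * τ)) ≤
      expRegret P π (tiltedLoss μ s m e) T (fun t => signMeasure (β t)) (m + τ • e) := by
  have hu : ∀ b, tiltedLoss μ s m e (m + τ • e) b = μ / 2 * τ ^ 2 + s * sgn b * τ := by
    intro b
    simp [tiltedLoss, norm_smul, he, inner_smul_right]
  have hmeas : ∀ b, Measurable fun x => tiltedLoss μ s m e x b := fun b => by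
    unfold tiltedLoss
    exact Continuous.measurable (by fun_prop)
  have hbound : ∀ x ∈ X, ∀ b, |tiltedLoss μ s m e x b| ≤ μ / 2 * D ^ 2 + |s| * D := by
    intro x hx b
    have h3 : |inner ℝ e (x - m)| ≤ D :=
      (by simpa [he] using abs_real_inner_le_norm e (x - m) : _ ≤ ‖x - m‖).trans (hD x hx)
    have h4 : |sgn b| = 1 := by cases b <;> simp [sgn]
    unfold tiltedLoss
    refine (abs_add_le _ _).trans ?_
    rw [abs_mul (s * sgn b), abs_mul s, h4, mul_one, abs_of_nonneg (by positivity)]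
    have := hD x hx
    gcongr
  have hint : ∀ t : Fin T, Integrable (fun z : Ω × (Fin T → Bool) =>
      tiltedLoss μ s m e (π.point z.1 z.2 t) (z.2 t) - tiltedLoss μ s m e (m + τ • e) (z.2 t))
      (P.prod (Measure.pi fun t : Fin T => signMeasure (β t))) := by
    intro t
    have hpoint : Measurable fun z : Ω × (Fin T → Bool) => π.point z.1 z.2 t :=
      (π.measurable_play t).comp (measurable_fst.prodMk
        (measurable_pi_lambda _ fun s => (measurable_pi_apply _).comp measurable_snd))
    have hf : Measurable (fun p : Euc d × Bool => tiltedLoss μ s m e p.1 p.2) :=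
      measurable_from_prod_countable_left hmeas
    have ht : Measurable fun z : Ω × (Fin T → Bool) => z.2 t :=
      (measurable_pi_apply t).comp measurable_snd
    refine Integrable.sub ?_ ?_
    · exact .of_bound (hf.comp (hpoint.prodMk ht)).aestronglyMeasurable _
        (.of_forall fun z => hbound _ (π.play_mem _ _ _) _)
    · have hc : Measurable (fun b => tiltedLoss μ s m e (m + τ • e) b) := measurable_of_countable _
      refine .of_bound (hc.comp ht).aestronglyMeasurable (|μ / 2 * τ ^ 2| + |s| * |τ|)
        (.of_forall fun z => ?_)
      simp only [hu]
      have h4 : |sgn (z.2 t)| = 1 := by cases z.2 t <;> simp [sgn]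
      refine (abs_add_le _ _).trans ?_
      rw [abs_mul (s * sgn _), abs_mul s, h4, mul_one]
  unfold expRegret
  rw [integral_finsetSum _ fun t _ => hint t, ← Fin.sum_univ_eq_sum_range (fun t =>
    signExp β t (fun h => μ / 2 * meanPlay P π m e t h ^ 2 +
      s * β t * meanPlay P π m e t h) - (μ / 2 * τ ^ 2 + s * β t * τ))]
  refine Finset.sum_le_sum fun t _ => ?_
  rw [integral_prod_symm _ (hint t), integral_pi_signMeasure h₁ h₂]
  have hstep : signExp β t (fun k => ∑ b, signWeight (β t) b *
      (μ / 2 * meanPlay P π m e t k ^ 2 + s * sgn b * meanPlay P π m e t k -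
        (μ / 2 * τ ^ 2 + s * sgn b * τ))) ≤
      signExp β T fun h => ∫ ω, (tiltedLoss μ s m e (π.point ω h t) (h t) -
        tiltedLoss μ s m e (m + τ • e) (h t)) ∂P := by
    refine (signExp_history β t fun k b =>
      μ / 2 * meanPlay P π m e t k ^ 2 + s * sgn b * meanPlay P π m e t k -
        (μ / 2 * τ ^ 2 + s * sgn b * τ)).symm.le.trans (signExp_mono h₁ h₂ T fun h => ?_)
    have hplay : Measurable fun ω => π.point ω h t :=
      (π.measurable_play t).comp (measurable_id.prodMk measurable_const)
    rw [integral_sub _ (integrable_const _), integral_const, hu]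
    · have := le_integral_tiltedLoss_play P π (s := s) hμ he hD t
        (fun i => h (Fin.castLE t.isLt.le i)) (h t)
      simp only [probReal_univ, one_smul]
      exact sub_le_sub_right this _
    · exact .of_bound ((hmeas _).comp hplay).aestronglyMeasurable _
        (.of_forall fun ω => hbound _ (π.play_mem _ _ _) _)
  refine le_trans (le_of_eq ?_) hstep
  rw [← signExp_const β t (μ / 2 * τ ^ 2 + s * β t * τ), sub_eq_add_neg, ← neg_one_mul,
    ← signExp_const_mul, ← signExp_add]
  congr 1
  funext h
  simp [signWeight, sgn]
  ring

/-- For the comparator that minimizes the mean loss of mean sign `θ`, a round of mean sign `θ`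
costs the squared error of the learner's estimate of `θ`, and any other round gains the
comparator at most `2 * s ^ 2 / μ`. -/
lemma estimation_error_le_expRegret (P : Measure Ω) [IsProbabilityMeasure P] (π : Policy X Ω Bool)
    {μ s D : ℝ} {m e : Euc d} (hμ : 0 < μ) (hs : 0 < s) (he : ‖e‖ = 1)
    (hD : ∀ x ∈ X, ‖x - m‖ ≤ D) (N k : ℕ) {β : ℕ → ℝ} (h₁ : ∀ t, -1 ≤ β t) (h₂ : ∀ t, β t ≤ 1)
    {θ : ℝ} (h₃ : -1 ≤ θ) (h₄ : θ ≤ 1) (hβ : ∀ t < N, β t = θ) :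
    s ^ 2 / (2 * μ) * ∑ n ∈ Finset.range N, signExp (fun _ => θ) n
        (fun h => (-(μ / s) * meanPlay P π m e n h - θ) ^ 2) - k * (2 * s ^ 2 / μ) ≤
      expRegret P π (tiltedLoss μ s m e) (N + k) (fun t => signMeasure (β t))
        (m + (-(θ * s / μ)) • e) := by
  refine le_trans ?_ (le_expRegret_tiltedLoss P π hμ.le he hD (N + k) h₁ h₂ _)
  have hround : ∀ t, signExp β t (fun h => μ / 2 * meanPlay P π m e t h ^ 2 +
        s * β t * meanPlay P π m e t h) -
        (μ / 2 * (-(θ * s / μ)) ^ 2 + s * β t * (-(θ * s / μ))) =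
      s ^ 2 / (2 * μ) * signExp β t
        (fun h => (-(μ / s) * meanPlay P π m e t h - β t) ^ 2) -
        s ^ 2 / (2 * μ) * (β t - θ) ^ 2 := by
    intro t
    have h5 : ∀ h : Fin t → Bool, μ / 2 * meanPlay P π m e t h ^ 2 +
        s * β t * meanPlay P π m e t h =
        s ^ 2 / (2 * μ) * (-(μ / s) * meanPlay P π m e t h - β t) ^ 2 +
        -(s ^ 2 / (2 * μ) * β t ^ 2) := by
      intro h
      field_simp
      ring
    simp only [h5]
    rw [signExp_add, signExp_const, signExp_const_mul]
    field_simp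
    ring
  rw [Finset.sum_congr rfl fun t _ => hround t, Finset.sum_range_add]
  have hfirst : ∑ t ∈ Finset.range N, (s ^ 2 / (2 * μ) * signExp β t
        (fun h => (-(μ / s) * meanPlay P π m e t h - β t) ^ 2) -
        s ^ 2 / (2 * μ) * (β t - θ) ^ 2) =
      s ^ 2 / (2 * μ) * ∑ n ∈ Finset.range N, signExp (fun _ => θ) n
        (fun h => (-(μ / s) * meanPlay P π m e n h - θ) ^ 2) := by
    rw [Finset.mul_sum]
    refine Finset.sum_congr rfl fun t ht => ?_
    have ht' := Finset.mem_range.mp ht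
    rw [signExp_congr (γ := fun _ => θ) fun i hi => hβ i (hi.trans ht'), hβ t ht']
    ring
  have hlast : ∑ _t ∈ Finset.range k, -(2 * s ^ 2 / μ) ≤
      ∑ t ∈ Finset.range k, (s ^ 2 / (2 * μ) * signExp β (N + t)
        (fun h => (-(μ / s) * meanPlay P π m e (N + t) h - β (N + t)) ^ 2) -
        s ^ 2 / (2 * μ) * (β (N + t) - θ) ^ 2) := by
    refine Finset.sum_le_sum fun t _ => ?_
    have h6 : 0 ≤ signExp β (N + t)
        (fun h => (-(μ / s) * meanPlay P π m e (N + t) h - β (N + t)) ^ 2) :=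
      Finset.sum_nonneg fun x _ => mul_nonneg
        (Finset.prod_nonneg fun i _ => signWeight_nonneg (h₁ i) (h₂ i) _) (sq_nonneg _)
    have h7 : (β (N + t) - θ) ^ 2 ≤ 4 := by
      have := h₁ (N + t)
      have := h₂ (N + t)
      nlinarith
    have h8 : 0 ≤ s ^ 2 / (2 * μ) := by positivity
    have h9 : 2 * s ^ 2 / μ = s ^ 2 / (2 * μ) * 4 := by field_simp; ring
    have := mul_le_mul_of_nonneg_left h7 h8
    have := mul_nonneg h8 h6
    linarith
  rw [Finset.sum_const, Finset.card_range, nsmul_eq_mul] at hlast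
  rw [hfirst]
  linarith

end Regret

/-! ### Choice of the segment, the window and the means -/

lemma exists_half_diam_lt_dist {d : ℕ} {X : Set (Euc d)} (hc : IsCompact X) (hX : X.Nontrivial) :
    ∃ a ∈ X, ∃ b ∈ X, Metric.diam X / 2 < dist a b := by
  by_contra! h
  have hpos := Metric.diam_pos hX hc.isBounded
  have := Metric.diam_le_of_forall_dist_le (by positivity) h
  linarith

/-- Once `T` exceeds a multiple of `r⁻⁴`, the scale `15 / (2 r²)` imposed by the prior on `[-r, r]`
is at most `√T`, so half of `log T` is left. -/
lemma log_le_log_window {T N : ℕ} {r ρ : ℝ} (hr : 0 < r) (hr1 : r ≤ 1 / 2) (hρ : 0 ≤ ρ)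
    (hrρ : 1 / (4 * (1 + ρ)) ≤ r) (hT : 14400 * (1 + ρ) ^ 4 ≤ (T : ℝ)) (hN : T = N + 3) :
    Real.log T / 2 ≤ Real.log (N + 15 / 2 / r ^ 2) - Real.log (15 / 2 / r ^ 2) := by
  have hinv : 1 / r ≤ 4 * (1 + ρ) := by
    rw [div_le_iff₀ (by positivity)] at hrρ
    rw [div_le_iff₀ hr]
    linarith
  have hK : 15 / 2 / r ^ 2 = 15 / 2 * (1 / r) ^ 2 := by field_simp
  have hinv2 : 2 ≤ 1 / r := by
    rw [le_div_iff₀ hr]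
    linarith
  have hK3 : 3 ≤ 15 / 2 / r ^ 2 := by
    rw [hK]
    nlinarith
  have hK2 : (15 / 2 / r ^ 2) ^ 2 ≤ T := by
    refine le_trans ?_ hT
    have h1 : (1 / r) ^ 4 ≤ (4 * (1 + ρ)) ^ 4 := by gcongr
    rw [hK]
    nlinarith [pow_nonneg (by linarith : 0 ≤ 1 + ρ) 4]
  have hKpos : 0 < 15 / 2 / r ^ 2 := by positivity
  have hlog1 : 2 * Real.log (15 / 2 / r ^ 2) ≤ Real.log T := by
    have := Real.log_le_log (by positivity) hK2
    rwa [Real.log_pow] at this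
  have hlog2 : Real.log T ≤ Real.log (N + 15 / 2 / r ^ 2) := by
    refine Real.log_le_log ?_ ?_
    · rw [hN]; positivity
    · rw [hN]; push_cast; linarith
  linarith

/-- A convex body contains, around some point `m`, a segment of half its diameter. -/
lemma exists_segment {d : ℕ} {X : Set (Euc d)} (hc : IsCompact X) (hconv : Convex ℝ X)
    (hX : X.Nontrivial) :
    ∃ m ∈ X, ∃ e : Euc d, ‖e‖ = 1 ∧ ∀ τ : ℝ, |τ| ≤ Metric.diam X / 4 → m + τ • e ∈ X := by
  have hpos := Metric.diam_pos hX hc.isBounded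
  obtain ⟨a, ha, b, hb, hab⟩ := exists_half_diam_lt_dist hc hX
  rw [dist_comm, dist_eq_norm] at hab
  have hl : 0 < ‖b - a‖ := by linarith
  refine ⟨(1 / 2 : ℝ) • a + (1 / 2 : ℝ) • b,
    hconv ha hb (by norm_num) (by norm_num) (by norm_num), ‖b - a‖⁻¹ • (b - a), ?_, ?_⟩
  · rw [norm_smul, norm_inv, norm_norm, inv_mul_cancel₀ hl.ne']
  intro τ hτ
  have h1 : |τ / ‖b - a‖| ≤ 1 / 2 := by
    rw [abs_div, abs_of_pos hl, div_le_iff₀ hl]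
    linarith
  have h2 := abs_le.mp h1
  rw [smul_smul, ← div_eq_mul_inv]
  have h3 : (1 / 2 : ℝ) • a + (1 / 2 : ℝ) • b + (τ / ‖b - a‖) • (b - a) =
      (1 / 2 - τ / ‖b - a‖) • a + (1 / 2 + τ / ‖b - a‖) • b := by
    module
  rw [h3]
  exact hconv ha hb (by linarith) (by linarith) (by ring)

section Maxima

variable {d : ℕ} {X : Set (Euc d)} {μ s : ℝ} {m e : Euc d} {β : ℕ → ℝ} {T t : ℕ}

lemma sigmaMaxSq_tiltedLoss (hX : X.Nonempty) (he : ‖e‖ = 1) (h₁ : ∀ t, -1 ≤ β t)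
    (h₂ : ∀ t, β t ≤ 1) (ht : t < T) (h0 : β t = 0) :
    sigmaMaxSq X (tiltedLoss μ s m e) T (fun t => signMeasure (β t)) = s ^ 2 := by
  have hval : ∀ t : Fin T, stochVar X (tiltedLoss μ s m e) (signMeasure (β t)) =
      s ^ 2 * (1 - β t ^ 2) := fun t => stochVar_tiltedLoss hX he (h₁ t) (h₂ t)
  have : Nonempty (Fin T) := ⟨⟨t, ht⟩⟩
  refine le_antisymm (ciSup_le fun t => ?_) ?_
  · rw [hval]
    linarith [mul_nonneg (sq_nonneg s) (sq_nonneg (β t))]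
  · refine le_ciSup_of_le (Set.finite_range _).bddAbove ⟨t, ht⟩ ?_
    rw [hval]
    simp [h0]

lemma bigSigmaMaxSq_tiltedLoss (hX : X.Nonempty) (he : ‖e‖ = 1) (h₁ : ∀ t, -1 ≤ β t)
    (h₂ : ∀ t, β t ≤ 1) (ht : t + 1 < T) (h0 : β t = 1) (h1 : β (t + 1) = -1) :
    bigSigmaMaxSq X (tiltedLoss μ s m e) T (fun t => signMeasure (β t)) = 4 * s ^ 2 := by
  have hval : ∀ t : Fin (T - 1), advVar X (tiltedLoss μ s m e) (signMeasure (β (t + 1)))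
      (signMeasure (β t)) = s ^ 2 * (β (t + 1) - β t) ^ 2 := fun t =>
    advVar_tiltedLoss hX he (h₁ _) (h₂ _) (h₁ _) (h₂ _)
  have : Nonempty (Fin (T - 1)) := ⟨⟨t, by lia⟩⟩
  refine le_antisymm (ciSup_le fun t => ?_) ?_
  · rw [hval]
    have h4 : (β (t + 1) - β t) ^ 2 ≤ 2 ^ 2 :=
      sq_le_sq' (by linarith [h₂ t, h₁ (t + 1)]) (by linarith [h₁ t, h₂ (t + 1)])
    linarith [mul_le_mul_of_nonneg_left h4 (sq_nonneg s)]
  · refine le_ciSup_of_le (Set.finite_range _).bddAbove ⟨t, by lia⟩ ?_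
    rw [hval]
    simp only [h0, h1]
    linarith

end Maxima

theorem theorem4 :
    ∃ c C : ℝ, 0 < c ∧ 0 < C ∧
      ∀ (d : ℕ) (X : Set (Euc d)), IsCompact X → Convex ℝ X → X.Nontrivial →
      ∀ (μ σ bigSigma : ℝ), 0 < μ → 0 < σ → 0 < bigSigma →
      ∀ T : ℕ, C * (1 + max σ bigSigma / (μ * Metric.diam X)) ^ 4 ≤ (T : ℝ) →
      ∀ (Ω : Type*) [MeasurableSpace Ω] (P : Measure Ω) [IsProbabilityMeasure P]
        (A : Learner X Ω),
      ∃ (Ξ : Type) (_ : MeasurableSpace Ξ) (f : Euc d → Ξ → ℝ) (D : ℕ → Measure Ξ),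
        (∀ t, IsProbabilityMeasure (D t)) ∧
        (∀ t < T, Assumptions X f (max σ (bigSigma / 2) + μ * Metric.diam X) μ μ (D t)) ∧
        σ ^ 2 ≤ sigmaMaxSq X f T D ∧
        bigSigma ^ 2 ≤ bigSigmaMaxSq X f T D ∧
        ∃ u ∈ X,
          c * ((sigmaMaxSq X f T D + bigSigmaMaxSq X f T D) / μ * Real.log T)
            ≤ expRegret P (A.policy Ξ f) f T D u := by
  -- The factor `14400` makes the prior scale at most `√T`; the factor `exp 100` lets `log T`
  -- absorb the loss in the last three rounds.
  refine ⟨1 / 100, 14400 * Real.exp 100, by norm_num, by positivity, ?_⟩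
  intro d X hXc hXconv hXn μ σ bigSigma hμ hσ hS T hT Ω _ P _ A
  set diam := Metric.diam X
  have hDpos : 0 < diam := Metric.diam_pos hXn hXc.isBounded
  set s := max σ (bigSigma / 2)
  have hσs : σ ≤ s := le_max_left _ _
  have hSs : bigSigma / 2 ≤ s := le_max_right _ _
  have hs : 0 < s := hσ.trans_le hσs
  set ρ := max σ bigSigma / (μ * diam) with hρ_def
  have hρ : 0 ≤ ρ := div_nonneg (hσ.le.trans (le_max_left _ _)) (by positivity)
  have hsρ : s ≤ ρ * (μ * diam) := by
    rw [hρ_def, div_mul_cancel₀ _ (by positivity)]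
    exact max_le_max le_rfl (by linarith)
  have hone : 1 ≤ (1 + ρ) ^ 4 := one_le_pow₀ (by linarith)
  have hexp : (1 : ℝ) ≤ Real.exp 100 := Real.one_le_exp (by norm_num)
  have hT1 : 14400 * (1 + ρ) ^ 4 ≤ (T : ℝ) := by
    refine le_trans ?_ hT
    gcongr
    linarith
  have hT2 : Real.exp 100 ≤ T := by
    refine le_trans ?_ hT
    nlinarith [hexp, hone]
  have hlogT : 100 ≤ Real.log T := by
    rw [Real.le_log_iff_exp_le (by linarith)]
    exact hT2
  obtain ⟨N, hN⟩ : ∃ N, T = N + 3 := by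
    have : (3 : ℝ) ≤ T := by linarith
    exact ⟨T - 3, by have : 3 ≤ T := by exact_mod_cast this
                     omega⟩
  obtain ⟨m, hm, e, he, hu⟩ := exists_segment hXc hXconv hXn
  have hDm : ∀ x ∈ X, ‖x - m‖ ≤ diam := fun x hx => by
    rw [← dist_eq_norm]
    exact Metric.dist_le_diam_of_mem hXc.isBounded hx hm
  -- In the window `[-r, r]` of mean signs the minimizer `m - (θ s / μ) • e` lies on the segment.
  obtain ⟨r, hr_def⟩ : ∃ r, r = min (1 / 2) (μ * diam / (4 * s)) := ⟨_, rfl⟩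
  have hr1 : r ≤ 1 / 2 := hr_def ▸ min_le_left _ _
  have hr2 : r * (4 * s) ≤ μ * diam := by
    rw [← le_div_iff₀ (by positivity)]
    exact hr_def ▸ min_le_right _ _
  have hr : 0 < r := hr_def ▸ lt_min (by norm_num) (by positivity)
  have hrρ : 1 / (4 * (1 + ρ)) ≤ r := by
    rw [hr_def]
    refine le_min ?_ ?_
    · rw [div_le_div_iff₀ (by positivity) (by norm_num)]
      linarith
    · rw [div_le_div_iff₀ (by positivity) (by positivity)]
      nlinarith [mul_pos hμ hDpos]
  have hwin := log_le_log_window hr hr1 hρ hrρ hT1 hN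
  obtain ⟨θ, hθ, hest⟩ := exists_mean_log_le hr hr1 N
    (fun n h => -(μ / s) * meanPlay P (A.policy Bool (tiltedLoss μ s m e)) m e n h)
    (B := Real.log T / 4) (by linarith)
  have hθ1 : -1 ≤ θ := by linarith [hθ.1]
  have hθ2 : θ ≤ 1 := by linarith [hθ.2]
  -- The signs `1, -1` of rounds `N` and `N + 1` create the variation, the fair sign of the
  -- last round creates the variance.
  obtain ⟨β, hβ⟩ : ∃ β : ℕ → ℝ, β = fun t =>
    if t < N then θ else if t = N then 1 else if t = N + 1 then -1 else 0 := ⟨_, rfl⟩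
  have hβN : ∀ t < N, β t = θ := fun t ht => by simp [hβ, ht]
  have hβ0 : β N = 1 := by simp [hβ]
  have hβ1 : β (N + 1) = -1 := by simp [hβ]
  have hβ2 : β (N + 2) = 0 := by simp [hβ]
  have h₁ : ∀ t, -1 ≤ β t := fun t => by
    rw [hβ]; dsimp only; split_ifs <;> linarith
  have h₂ : ∀ t, β t ≤ 1 := fun t => by
    rw [hβ]; dsimp only; split_ifs <;> linarith
  have hσsup := sigmaMaxSq_tiltedLoss (μ := μ) (s := s) (m := m) hXn.nonempty he h₁ h₂
    (by lia : N + 2 < T) hβ2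
  have hSsup := bigSigmaMaxSq_tiltedLoss (μ := μ) (s := s) (m := m) hXn.nonempty he h₁ h₂
    (by lia : N + 1 < T) hβ0 hβ1
  refine ⟨Bool, inferInstance, tiltedLoss μ s m e, fun t => signMeasure (β t),
    fun t => isProbabilityMeasure_signMeasure (h₁ t) (h₂ t), fun t _ =>
      tiltedLoss_assumptions hXconv hμ.le hs.le hDm he (h₁ t) (h₂ t), ?_, ?_,
    m + (-(θ * s / μ)) • e, hu _ ?_, ?_⟩
  · rw [hσsup]
    exact pow_le_pow_left₀ hσ.le hσs 2
  · rw [hSsup]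
    linarith [pow_le_pow_left₀ (by positivity : 0 ≤ bigSigma / 2) hSs 2]
  · rw [abs_neg, abs_div, abs_mul, abs_of_pos hs, abs_of_pos hμ, div_le_iff₀ hμ]
    have := mul_le_mul_of_nonneg_right (abs_le.mpr hθ) hs.le
    linarith
  · have hreg := estimation_error_le_expRegret P (A.policy Bool (tiltedLoss μ s m e))
      hμ hs he hDm N 3 h₁ h₂ hθ1 hθ2 hβN
    rw [← hN] at hreg
    rw [hσsup, hSsup]
    refine le_trans ?_ hreg
    have h5 := mul_le_mul_of_nonneg_left hest (by positivity : 0 ≤ s ^ 2 / (2 * μ))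
    refine le_trans ?_ (sub_le_sub_right h5 _)
    have h6 := mul_le_mul_of_nonneg_left hlogT (by positivity : 0 ≤ s ^ 2 / μ)
    have e1 : s ^ 2 / (2 * μ) = s ^ 2 / μ / 2 := by field_simp
    have e2 : 2 * s ^ 2 / μ = 2 * (s ^ 2 / μ) := by ring
    have e3 : (s ^ 2 + 4 * s ^ 2) / μ = 5 * (s ^ 2 / μ) := by ring
    rw [e1, e2, e3]
    push_cast
    linarith [(by positivity : 0 ≤ s ^ 2 / μ)]
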